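/- An a.d.-family is an uncountable family $\mathcal{A}$ of infinite subsets of $\mathbb{N}$ such that $A\cap B$ is finite for any two distinct $A,B\in\mathcal{A}$. A pairing of $\mathcal{A}$ is a map $\phi=(\phi_1,\phi_{-1}):\kappa\to\mathcal{A}\times\mathcal{A}$, where $\kappa=|\mathcal{A}|$, such that $\phi_1(\alpha)\neq\phi_{-1}(\alpha)$ for every $\alpha<\kappa$ and $\{\phi_1(\alpha),\phi_{-1}(\alpha)\}\cap\{\phi_1(\beta),\phi_{-1}(\beta)\}=\emptyset$ for all distinct $\alpha,\beta<\kappa$. Let $\mathcal{X}_{\mathcal{A}}$ be the closed linear span of $c_0\cup\{1_A: A\in\mathcal{A}\}$ in the real Banach space $\ell_\infty$, let $\mathcal{X}_{\mathcal{A},\phi}\subseteq\mathcal{X}_{\mathcal{A}}$ be the closed linear span of $c_0\cup\{1_{\phi_1(\alpha)}-1_{\phi_{-1}(\alpha)}:\alpha<\kappa\}$, and let $\|f\|_{\infty,2}=\|f\|_\infty+\sqrt{\sum_{n\in\mathbb{N}} f(n)^2/2^{n+1}}$, a norm on $\ell_\infty$ equivalent to $\|\cdot\|_\infty$. **Theorem.**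 Assume the Continuum Hypothesis (which is consistent with ZFC, so that the following conclusion is consistent with ZFC as well). For every $\rho>0$ there are an a.d.-family $\mathcal{A}$, a pairing $\phi$ of $\mathcal{A}$ and a nonseparable Banach space $(\mathcal{X},\|\cdot\|)$, which is a subspace of $(\mathcal{X}_{\mathcal{A},\phi},\|\cdot\|_{\infty,2})$ and hence of $(\mathcal{X}_{\mathcal{A}},\|\cdot\|_{\infty,2})$, such that for every $\delta>0$ there is $\varepsilon>0$ such that, whenever $\mathcal{Y}$ is an uncountable subset of the unit sphere of $\mathcal{X}$ with $\|x-y\|\geq 1-\varepsilon$ for all distinct $x,y\in\mathcal{Y}$, then - there are distinct $x,y\in\mathcal{Y}$ such that $\|x-y\|<1$, and - there are $x,y\in\mathcal{Y}$ such that $\|x-y\|>2-\delta-\rho$. -/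

import Mathlib

open scoped ENNReal Topology Cardinal

noncomputable section

namespace ADSpace

/-- The Banach space `ℓ_∞` of bounded real sequences with the supremum norm. -/
abbrev EllInf : Type := lp (fun _ : ℕ => ℝ) ∞

/-- An a.d.-family: an uncountable family of infinite subsets of `ℕ`, any two distinct members
of which have finite intersection. -/
structure IsADFamily (𝒜 : Set (Set ℕ)) : Prop where
  uncountable : ¬ 𝒜.Countable
  infinite : ∀ A ∈ 𝒜, A.Infinite
  almostDisjoint : ∀ A ∈ 𝒜, ∀ B ∈ 𝒜, A ≠ B → (A ∩ B).Finite

/-- The characteristic function `1_A` of `A ⊆ ℕ`, as an element of `ℓ_∞`. -/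
def charFn (A : Set ℕ) : EllInf :=
  ⟨A.indicator 1, memℓp_infty ⟨1, by
    rintro _ ⟨n, rfl⟩
    by_cases h : n ∈ A <;> simp [h]⟩⟩

/-- The subset `c₀` of `ℓ_∞`: the sequences converging to zero. -/
def cZero : Set EllInf :=
  {f | Filter.Tendsto (fun n => f n) Filter.atTop (𝓝 0)}

/-- The space `𝒳_𝒜`: the closed linear span in `ℓ_∞` of `c₀ ∪ {1_A : A ∈ 𝒜}`. -/
def spaceX (𝒜 : Set (Set ℕ)) : Submodule ℝ EllInf :=
  (Submodule.span ℝ (cZero ∪ charFn '' 𝒜)).topologicalClosure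

/-- The norm `‖f‖_{∞,2} = ‖f‖_∞ + (∑ₙ f(n)² / 2^(n+1))^(1/2)`; the series converges for every
bounded `f`. -/
def normInfTwo (f : EllInf) : ℝ :=
  ‖f‖ + Real.sqrt (∑' n : ℕ, f n ^ 2 / 2 ^ (n + 1))

/-- A pairing `φ = (φ₁, φ₋₁)` of `𝒜`: a family, indexed by a set of the cardinality of `𝒜` (here
`𝒜` itself serves as the index set), of pairs of distinct members of `𝒜` such that pairs with
different indices have no member in common. -/
structure IsPairing {𝒜 : Set (Set ℕ)} (φ : 𝒜 → 𝒜 × 𝒜) : Prop where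
  ne : ∀ α, (φ α).1 ≠ (φ α).2
  disjoint : ∀ α β, α ≠ β →
    Disjoint ({(φ α).1, (φ α).2} : Set 𝒜) {(φ β).1, (φ β).2}

/-- The space `𝒳_{𝒜,φ}`: the closed linear span in `ℓ_∞` of
`c₀ ∪ {1_{φ₁(α)} - 1_{φ₋₁(α)} : α}`. -/
def spaceXPairing {𝒜 : Set (Set ℕ)} (φ : 𝒜 → 𝒜 × 𝒜) : Submodule ℝ EllInf :=
  (Submodule.span ℝ
    (cZero ∪ Set.range fun α => charFn (φ α).1 - charFn (φ α).2)).topologicalClosure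

/-- `𝒳_{𝒜,φ}` is a subspace of `𝒳_𝒜`. -/
theorem spaceXPairing_le {𝒜 : Set (Set ℕ)} (φ : 𝒜 → 𝒜 × 𝒜) :
    spaceXPairing φ ≤ spaceX 𝒜 := by
  refine Submodule.topologicalClosure_mono (Submodule.span_le.2 ?_)
  rintro f (hf | ⟨α, rfl⟩)
  · exact Submodule.subset_span (Or.inl hf)
  · exact Submodule.sub_mem _
      (Submodule.subset_span (Or.inr ⟨_, (φ α).1.2, rfl⟩))
      (Submodule.subset_span (Or.inr ⟨_, (φ α).2.2, rfl⟩))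

end ADSpace

end

/-! Code the nodes of the tree of finite sequences of letters, each with an optional sign as a tag,
by integers. A branch x yields two disjoint sets A, B: a tagged node goes to the side of its tag, an
untagged one to the side given by the sign of the letter that x reads next. Distinct branches share
only finitely many nodes, so these sets are almost disjoint; the vectors f_x = 1_A - 1_B together
with c₀ generate the space.

CH gives ω₁ branches so generic, in the manner of a Luzin set (`exists_generic_branches`), that
every uncountable family of increasing tuples contains two tuples that agree on a fixed set of
coordinates and, on all the others, split at one common level with prescribed letters
(`exists_simultaneous_splitting`).

Approximate uncountably many members of 𝒴 by g + ∑ q_i f_{x_i} with common g and q, and let Q be the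
largest |q_i| over the splitting coordinates. The second bit of a letter lets branches split with
equal signs: the combinations then agree up to the split, and above it a point sees at most one
uncancelled summand, so the difference has sup norm at most Q and negligible weighted norm
(`abs_comb_sub_comb_apply_le`). Opposite signs produce the value 2q_i at the untagged node of the
split (`two_mul_abs_le_norm_comb_sub_comb`).

Uncountably many unit vectors have weighted norm above some c > 0, so Q is at most about 1 - c and
the first pair is closer than 1. The same pair is at least 1 - ε apart, so Q is almost 1 - ε, and
the second pair is almost 2 - 2ε apart. One space serves every ρ. -/

namespace ADSpace

/-! ### Sequences of branches and Baire category of sections. -/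

/-- The letters of the tree; the first component of a letter is its sign. -/
abbrev Letter : Type := Bool × Bool

/-- Branches of the tree of finite sequences of letters. -/
abbrev Branch : Type := ℕ → Letter

/-- Prepend a term to a sequence. -/
def consSeq {α : Type*} (x : α) (f : ℕ → α) : ℕ → α
  | 0 => x
  | n + 1 => f n

/-- Prepend a list to a sequence. -/
def appendSeq {α : Type*} (l : List α) (f : ℕ → α) : ℕ → α :=
  l.foldr consSeq f

/-- The section of a set of sequences at a given first term. -/
def sectionAt {α : Type*} (N : Set (ℕ → α)) (x : α) : Set (ℕ → α) :=
  {f | consSeq x f ∈ N}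

/-- The section of a set of sequences at a given list of first terms. -/
def sectionsAt {α : Type*} (N : Set (ℕ → α)) (l : List α) : Set (ℕ → α) :=
  l.foldl sectionAt N

theorem mem_sectionsAt {α : Type*} (l : List α) (N : Set (ℕ → α)) (f : ℕ → α) :
    f ∈ sectionsAt N l ↔ appendSeq l f ∈ N := by
  induction l generalizing N with
  | nil => rfl
  | cons x l ih => exact ih (sectionAt N x)

theorem appendSeq_apply {α : Type*} (l : List α) (f : ℕ → α) (n : ℕ) (h : n < l.length) :
    appendSeq l f n = l[n] := by
  induction l generalizing n with
  | nil => simp at h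
  | cons x l ih =>
    cases n with
    | zero => rfl
    | succ n => exact ih n (by simpa using h)

section Topology

variable {α : Type*} [TopologicalSpace α]

theorem continuous_consSeq : Continuous fun p : α × (ℕ → α) => consSeq p.1 p.2 := by
  refine continuous_pi fun n => ?_
  cases n with
  | zero => exact continuous_fst
  | succ n => exact (continuous_apply n).comp continuous_snd

theorem isClosed_sectionAt {N : Set (ℕ → α)} (hN : IsClosed N) (x : α) :
    IsClosed (sectionAt N x) :=
  hN.preimage (continuous_consSeq.comp (Continuous.prodMk_right x))

theorem isClosed_sectionsAt {N : Set (ℕ → α)} (hN : IsClosed N) (l : List α) :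
    IsClosed (sectionsAt N l) := by
  induction l generalizing N with
  | nil => exact hN
  | cons x l ih => exact ih (isClosed_sectionAt hN x)

/-- The Kuratowski–Ulam theorem for closed sets of sequences. -/
theorem isMeagre_setOf_interior_sectionAt_nonempty [SecondCountableTopology α]
    {N : Set (ℕ → α)} (hN : IsClosed N) (hN' : interior N = ∅) :
    IsMeagre {x | (interior (sectionAt N x)).Nonempty} := by
  obtain ⟨b, hbc, hbe, hb⟩ := TopologicalSpace.exists_countable_basis (ℕ → α)
  -- If V lay in the sections at all x of a nonempty open U, then N would contain the open set U ×
  -- V.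
  have key : ∀ V ∈ b, IsMeagre {x | V ⊆ sectionAt N x} := by
    intro V hV
    have hclosed : IsClosed {x | V ⊆ sectionAt N x} := by
      have : {x | V ⊆ sectionAt N x} = ⋂ v ∈ V, {x | consSeq x v ∈ N} := by
        ext x; simp [sectionAt, Set.subset_def]
      rw [this]
      exact isClosed_biInter fun v _ =>
        hN.preimage (continuous_consSeq.comp (Continuous.prodMk_left v))
    refine IsNowhereDense.isMeagre (hclosed.isNowhereDense_iff.2 ?_)
    by_contra hne
    obtain ⟨x, hx⟩ := Set.nonempty_iff_ne_empty.2 hne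
    obtain ⟨v, hv⟩ : V.Nonempty := by
      rw [Set.nonempty_iff_ne_empty]; rintro rfl; exact hbe hV
    have hopen : IsOpen {f : ℕ → α | f 0 ∈ interior {x | V ⊆ sectionAt N x} ∧
        (fun n => f (n + 1)) ∈ V} :=
      (isOpen_interior.preimage (continuous_apply 0)).inter
        ((hb.isOpen hV).preimage (continuous_pi fun n => continuous_apply (n + 1)))
    have hsub : {f : ℕ → α | f 0 ∈ interior {x | V ⊆ sectionAt N x} ∧
        (fun n => f (n + 1)) ∈ V} ⊆ N := by
      rintro f ⟨h0, h1⟩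
      have h2 : consSeq (f 0) (fun n => f (n + 1)) ∈ N := interior_subset h0 h1
      have h3 : consSeq (f 0) (fun n => f (n + 1)) = f := by
        funext n; cases n <;> rfl
      rwa [h3] at h2
    have : consSeq x v ∈ interior N := interior_maximal hsub hopen ⟨hx, hv⟩
    rw [hN'] at this
    exact this
  refine (isMeagre_biUnion hbc key).mono ?_
  rintro x ⟨f, hf⟩
  obtain ⟨V, hV, hfV, hVs⟩ := hb.exists_subset_of_mem_open hf isOpen_interior
  exact Set.mem_biUnion hV (hVs.trans interior_subset)

end Topology

/-! ### A generic family of branches under CH. -/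

/-- A closed set is determined by the basic open sets that miss it. The bound allows closed sets to
be indexed by `I`. -/
theorem mk_closeds_le_continuum (α : Type) [TopologicalSpace α] [SecondCountableTopology α] :
    #(TopologicalSpace.Closeds α) ≤ 𝔠 := by
  obtain ⟨b, hbc, -, hb⟩ := TopologicalSpace.exists_countable_basis α
  have : Function.Injective fun N : TopologicalSpace.Closeds α => {V : b | Disjoint (V : Set α) N} := by
    intro N M h
    have aux : ∀ N M : TopologicalSpace.Closeds α,
        {V : b | Disjoint (V : Set α) N} = {V : b | Disjoint (V : Set α) M} →
        (N : Set α) ⊆ M := by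
      intro N M h x hx
      by_contra hxM
      obtain ⟨V, hV, hxV, hVs⟩ := hb.exists_subset_of_mem_open
        (show x ∈ (M : Set α)ᶜ from hxM) M.isClosed.isOpen_compl
      have : (⟨V, hV⟩ : b) ∈ {V : b | Disjoint (V : Set α) N} := by
        rw [h]; exact Set.disjoint_left.2 fun y hy hyM => hVs hy hyM
      exact Set.disjoint_left.1 this hxV hx
    exact TopologicalSpace.Closeds.ext ((aux N M h).antisymm (aux M N h.symm))
  refine (Cardinal.mk_le_of_injective this).trans ?_
  have hb' : #b ≤ ℵ₀ := Cardinal.mk_le_aleph0_iff.2 hbc.to_subtype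
  rw [Cardinal.mk_set, ← Cardinal.two_power_aleph0]
  exact Cardinal.power_le_power_left two_ne_zero hb'

theorem exists_of_wellFounded_recursion {I β : Type*} [LT I] [WellFoundedLT I]
    (P : (a : I) → ((b : I) → b < a → β) → β → Prop) (h : ∀ a f, ∃ x, P a f x) :
    ∃ r : I → β, ∀ a, P a (fun b _ => r b) (r a) := by
  choose g hg using h
  refine ⟨IsWellFounded.fix (· < ·) fun a f => g a f, fun a => ?_⟩
  rw [IsWellFounded.fix_eq]
  exact hg a _

theorem isMeagre_singleton_branch (x : Branch) : IsMeagre {x} := by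
  refine IsNowhereDense.isMeagre (isClosed_singleton.isNowhereDense_iff.2 ?_)
  rw [interior_eq_empty_iff_dense_compl]
  -- No branch is isolated: changing the sign of the letter at n gives branches different from x
  -- that converge to x.
  have : Filter.Tendsto (fun n : ℕ => Function.update x n (!(x n).1, true)) Filter.atTop (𝓝 x) := by
    refine tendsto_pi_nhds.2 fun m => tendsto_const_nhds.congr' ?_
    filter_upwards [Filter.eventually_gt_atTop m] with n hn
    rw [Function.update_of_ne hn.ne]
  intro y
  by_cases hy : y = x
  · subst hy
    refine mem_closure_of_tendsto this (Filter.Eventually.of_forall fun n h => ?_)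
    have := congrArg Prod.fst (congrFun h n)
    simp at this
  · exact subset_closure hy

/-- Under the continuum hypothesis there is an injective family of branches of length `ω₁` all of
whose increasing finite subfamilies with large indices are generic. -/
theorem exists_generic_branches {I : Type} [LinearOrder I] [WellFoundedLT I]
    (hI : ∀ a : I, (Set.Iio a).Countable) (hcard : #I = 𝔠) :
    ∃ r : I → Branch, Function.Injective r ∧
      ∀ N : Set (ℕ → Branch), IsClosed N → interior N = ∅ → ∃ ξ : I, ∀ l : List I,
        l.Pairwise (· < ·) → (∀ a ∈ l, ξ < a) → interior (sectionsAt N (l.map r)) = ∅ := by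
  have : #(TopologicalSpace.Closeds (ℕ → Branch)) ≤ #I :=
    hcard ▸ mk_closeds_le_continuum _
  obtain ⟨e⟩ := Cardinal.le_def _ _ |>.1 this
  -- Stage a avoids countably many meagre sets: the earlier branches and, for each closed set coded
  -- below a and each finite list of earlier branches with nowhere dense section, the exceptional
  -- set of Kuratowski–Ulam.
  obtain ⟨r, hr⟩ := exists_of_wellFounded_recursion (I := I) (β := Branch)
    (fun a f x => (∀ b (h : b < a), f b h ≠ x) ∧
      ∀ N : TopologicalSpace.Closeds (ℕ → Branch), e N < a → ∀ l : List (Set.Iio a),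
        interior (sectionsAt (N : Set (ℕ → Branch)) (l.map fun b : Set.Iio a => f b b.2)) = ∅ →
        interior (sectionAt (sectionsAt (N : Set (ℕ → Branch)) (l.map fun b : Set.Iio a => f b b.2)) x) = ∅) (by
      intro a f
      have hc : Countable (Set.Iio a) := (hI a).to_subtype
      have h1 : IsMeagre (⋃ b : Set.Iio a, {f b b.2}) :=
        isMeagre_iUnion fun b => isMeagre_singleton_branch _
      have hNc : {N : TopologicalSpace.Closeds (ℕ → Branch) | e N < a}.Countable :=
        (hI a).preimage e.injective
      have h2 : IsMeagre (⋃ N ∈ {N : TopologicalSpace.Closeds (ℕ → Branch) | e N < a},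
          ⋃ l : List (Set.Iio a), {x |
            interior (sectionsAt (N : Set (ℕ → Branch)) (l.map fun b : Set.Iio a => f b b.2)) = ∅ ∧
            (interior (sectionAt (sectionsAt (N : Set (ℕ → Branch))
              (l.map fun b : Set.Iio a => f b b.2)) x)).Nonempty}) := by
        refine isMeagre_biUnion hNc fun N _ => isMeagre_iUnion fun l => ?_
        by_cases h : interior (sectionsAt (N : Set (ℕ → Branch)) (l.map fun b : Set.Iio a => f b b.2)) = ∅
        · exact (isMeagre_setOf_interior_sectionAt_nonempty
            (isClosed_sectionsAt N.isClosed _) h).mono fun x hx => hx.2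
        · exact IsMeagre.empty.mono fun x hx => h hx.1
      obtain ⟨x, hx⟩ := (dense_of_mem_residual (h1.union h2)).nonempty
      rw [Set.mem_compl_iff, Set.mem_union, not_or] at hx
      refine ⟨x, fun b hb hbx => hx.1 (Set.mem_iUnion.2 ⟨⟨b, hb⟩, hbx.symm⟩), ?_⟩
      intro N hN l hl
      by_contra hne
      exact hx.2 (Set.mem_biUnion (show N ∈ {N | e N < a} from hN)
        (Set.mem_iUnion.2 ⟨l, hl, Set.nonempty_iff_ne_empty.2 hne⟩)))
  refine ⟨r, ?_, fun N hN hN' => ⟨e ⟨N, hN⟩, fun l => ?_⟩⟩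
  · intro a b hab
    rcases lt_trichotomy a b with h | h | h
    · exact ((hr b).1 a h hab).elim
    · exact h
    · exact ((hr a).1 b h hab.symm).elim
  -- Peel off the largest index: it was chosen after all the others and after N was listed.
  · induction l using List.reverseRecOn with
    | nil => intro _ _; exact hN'
    | append_singleton l a ih =>
      intro hl hξ
      rw [List.pairwise_append] at hl
      have hla : ∀ b ∈ l, b < a := fun b hb => hl.2.2 b hb a (by simp)
      have h1 := ih hl.1 fun b hb => hξ b (by simp [hb])
      have h2 := (hr a).2 ⟨N, hN⟩ (hξ a (by simp)) (l.attach.map fun b => ⟨b.1, hla b.1 b.2⟩)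
      have h3 : (l.attach.map fun b => (⟨b.1, hla b.1 b.2⟩ : Set.Iio a)).map
          (fun b : Set.Iio a => r b) = l.map r := by
        rw [List.map_map]
        exact List.attach_map_val (f := r)
      rw [h3] at h2
      simpa [sectionsAt, List.foldl_append] using h2 h1

/-! ### Simultaneous splitting of uncountably many tuples. -/

theorem exists_cylinder_subset {f : ℕ → Branch} {U : Set (ℕ → Branch)} (hU : U ∈ 𝓝 f) :
    ∃ K : ℕ, ∀ g : ℕ → Branch, (∀ i < K, ∀ j < K, g i j = f i j) → g ∈ U := by
  by_contra! h
  choose g hg hgU using h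
  have : Filter.Tendsto g Filter.atTop (𝓝 f) := by
    refine tendsto_pi_nhds.2 fun i => tendsto_pi_nhds.2 fun j => tendsto_const_nhds.congr' ?_
    filter_upwards [Filter.eventually_gt_atTop i, Filter.eventually_gt_atTop j] with n hi hj
    exact (hg n i hi j hj).symm
  obtain ⟨n, hn⟩ := (this.eventually hU).exists
  exact hgU n hn

theorem cylinder_mem_nhds (f : ℕ → Branch) (K : ℕ) :
    {g : ℕ → Branch | ∀ i < K, ∀ j < K, g i j = f i j} ∈ 𝓝 f := by
  have : {g : ℕ → Branch | ∀ i < K, ∀ j < K, g i j = f i j} =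
      ⋂ i ∈ Set.Iio K, ⋂ j ∈ Set.Iio K, {g | g i j = f i j} := by
    ext g; simp
  rw [this, Filter.biInter_mem (Set.finite_Iio K)]
  intro i _
  rw [Filter.biInter_mem (Set.finite_Iio K)]
  intro j _
  have hc : Continuous fun g : ℕ → Branch => g i j := by fun_prop
  exact ((isOpen_discrete {f i j}).preimage hc).mem_nhds rfl

/-- Uncountably many increasing tuples of indices of a generic family of branches contain, outside
a fixed set of coordinates where they agree, pairs which split simultaneously with prescribed
letters. -/
theorem exists_simultaneous_splitting {I : Type} [LinearOrder I]
    (hI : ∀ a : I, (Set.Iic a).Countable) {r : I → Branch}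
    (hr : ∀ N : Set (ℕ → Branch), IsClosed N → interior N = ∅ → ∃ ξ : I, ∀ l : List I,
        l.Pairwise (· < ·) → (∀ a ∈ l, ξ < a) → interior (sectionsAt N (l.map r)) = ∅)
    {n : ℕ} {Z : Set (Fin n → I)} (hZ : ¬ Z.Countable) (hmono : ∀ z ∈ Z, StrictMono z) :
    ∃ J : Finset (Fin n), J ≠ Finset.univ ∧ ∀ a b : Letter, ∃ K : ℕ, ∃ z ∈ Z, ∃ w ∈ Z,
      (∀ i ∈ J, z i = w i) ∧ ∀ i ∉ J, (∀ j < K, r (z i) j = r (w i) j) ∧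
        r (z i) K = a ∧ r (w i) K = b := by
  classical
  obtain ⟨z₀, -⟩ : Z.Nonempty := by
    rw [Set.nonempty_iff_ne_empty]; rintro rfl; exact hZ Set.countable_empty
  -- A maximal set of coordinates that can be frozen while keeping uncountably many tuples; every
  -- other coordinate then takes each value only countably often, hence can be pushed above any ξ.
  obtain ⟨J, ⟨c, hJc⟩, hJmax⟩ := Set.Finite.exists_maximal
    (s := {J : Finset (Fin n) | ∃ c : Fin n → I, ¬ {z ∈ Z | ∀ i ∈ J, z i = c i}.Countable})
    (Set.toFinite _) ⟨∅, z₀, by simpa using hZ⟩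
  set Z' := {z ∈ Z | ∀ i ∈ J, z i = c i} with hZ'
  have hfib : ∀ i ∉ J, ∀ a : I, {z ∈ Z' | z i = a}.Countable := by
    intro i hi a
    by_contra hcon
    have : insert i J ≤ J := by
      refine hJmax ⟨Function.update c i a, fun h => hcon (h.mono ?_)⟩ (Finset.subset_insert _ _)
      rintro z ⟨⟨hz, hzc⟩, hza⟩
      refine ⟨hz, fun j hj => ?_⟩
      by_cases hji : j = i
      · subst hji; simpa using hza
      · rw [Function.update_of_ne hji]
        exact hzc j ((Finset.mem_insert.1 hj).resolve_left hji)
    exact hi (this (Finset.mem_insert_self _ _))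
  have habove : ∀ ξ : I, ∃ z ∈ Z', ∀ i ∉ J, ξ < z i := by
    intro ξ
    by_contra! hcon
    refine hJc (Set.Countable.mono (s₂ := ⋃ i ∈ {i | i ∉ J}, ⋃ a ∈ Set.Iic ξ, {z ∈ Z' | z i = a})
      ?_ ((Set.to_countable _).biUnion fun i hi => (hI ξ).biUnion fun a _ => hfib i hi a))
    intro z hz
    obtain ⟨i, hi, hzi⟩ := hcon z hz
    exact Set.mem_biUnion (show i ∈ {i | i ∉ J} from hi) (Set.mem_biUnion hzi ⟨hz, rfl⟩)
  let js : List (Fin n) := (List.finRange n).filter (· ∉ J)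
  have hjs : ∀ i, i ∈ js ↔ i ∉ J := fun i => by simp [js]
  have hjsorted : js.Pairwise (· < ·) := (List.pairwise_lt_finRange n).filter _
  let S : Set (ℕ → Branch) := {g | ∃ z ∈ Z', ∃ f, g = appendSeq ((js.map z).map r) f}
  -- Otherwise genericity makes the section of `closure S` at some tuple of the family nowhere
  -- dense, yet that section is everything.
  have hne : (interior (closure S)).Nonempty := by
    by_contra hemp
    obtain ⟨ξ, hξ⟩ := hr (closure S) isClosed_closure (Set.not_nonempty_iff_eq_empty.1 hemp)
    obtain ⟨z, hz, hzξ⟩ := habove ξ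
    have h1 := hξ (js.map z)
      (hjsorted.map z fun i j h => hmono z hz.1 h)
      (by
        intro a ha
        obtain ⟨i, hi, rfl⟩ := List.mem_map.1 ha
        exact hzξ i ((hjs i).1 hi))
    have h2 : sectionsAt (closure S) ((js.map z).map r) = Set.univ :=
      Set.eq_univ_of_forall fun f => (mem_sectionsAt _ _ _).2 (subset_closure ⟨z, hz, f, rfl⟩)
    rw [h2, interior_univ] at h1
    exact Set.univ_nonempty.ne_empty h1
  refine ⟨J, ?_, ?_⟩
  · rintro rfl
    refine hJc ((Set.countable_singleton c).mono ?_)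
    rintro z ⟨-, hz⟩
    exact funext fun i => hz i (Finset.mem_univ _)
  · obtain ⟨f₀, hf₀⟩ := hne
    obtain ⟨K, hK⟩ := exists_cylinder_subset (isOpen_interior.mem_nhds hf₀)
    have pick : ∀ a : Letter, ∃ z ∈ Z', ∀ i ∉ J, ∃ m, js[m]? = some i ∧
        (∀ j < K, r (z i) j = f₀ m j) ∧ r (z i) K = a := by
      intro a
      -- Changing the letters at level K stays in the cylinder, so any letter a can be realised at K
      -- on all free coordinates at once.
      let f₁ : ℕ → Branch := fun i j => if j = K then a else f₀ i j
      have hf₁ : f₁ ∈ closure S := interior_subset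
        (hK f₁ fun i _ j hj => by simp [f₁, hj.ne])
      obtain ⟨g, hg, z, hz, f, rfl⟩ := mem_closure_iff_nhds.1 hf₁ _
        (cylinder_mem_nhds f₁ (max (K + 1) n))
      refine ⟨z, hz, fun i hi => ?_⟩
      obtain ⟨m, hm, hmi⟩ := List.getElem_of_mem ((hjs i).2 hi)
      have hmn : m < n := hm.trans_le
        ((List.length_filter_le _ _).trans (List.length_finRange (n := n)).le)
      have hval : appendSeq ((js.map z).map r) f m = r (z i) := by
        rw [appendSeq_apply _ _ _ (by simpa using hm)]
        simp [hmi]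
      refine ⟨m, by rw [List.getElem?_eq_getElem hm, hmi], fun j hj => ?_, ?_⟩
      · rw [← hval, hg m (by omega) j (by omega)]
        simp [f₁, hj.ne]
      · rw [← hval, hg m (by omega) K (by omega)]
        simp [f₁]
    intro a b
    obtain ⟨z, hz, hza⟩ := pick a
    obtain ⟨w, hw, hwb⟩ := pick b
    refine ⟨K, z, hz.1, w, hw.1, fun i hi => (hz.2 i hi).trans (hw.2 i hi).symm, fun i hi => ?_⟩
    obtain ⟨m, hm, hm1, hm2⟩ := hza i hi
    obtain ⟨m', hm', hm1', hm2'⟩ := hwb i hi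
    have hnd : js.Nodup := hjsorted.imp fun h => h.ne
    have hmm : m = m' := by
      obtain ⟨h1, h2⟩ := List.getElem?_eq_some_iff.1 hm
      obtain ⟨h1', h2'⟩ := List.getElem?_eq_some_iff.1 hm'
      exact (hnd.getElem_inj_iff (hi := h1) (hj := h1')).1 (h2.trans h2'.symm)
    subst hmm
    exact ⟨fun j hj => (hm1 j hj).trans (hm1' j hj).symm, hm2, hm2'⟩

/-- Under the continuum hypothesis there is a well-ordered index type of cardinality `𝔠` with
countable initial segments. -/
theorem exists_index_type (CH : (𝔠 : Cardinal.{0}) = ℵ₁) :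
    ∃ (I : Type) (_ : LinearOrder I) (_ : WellFoundedLT I),
      (∀ a : I, (Set.Iic a).Countable) ∧ #I = 𝔠 := by
  refine ⟨(Cardinal.ord ℵ₁).ToType, inferInstance, inferInstance, fun a => ?_, ?_⟩
  · have h : (Set.Iio a).Countable := by
      rw [← Cardinal.le_aleph0_iff_set_countable]
      have := Cardinal.mk_Iio_lt a (by simp)
      rw [Cardinal.mk_toType, Cardinal.card_ord] at this
      exact Order.lt_succ_iff.1 (this.trans_eq Cardinal.succ_aleph0.symm)
    rw [← Set.Iio_insert]
    exact h.insert a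
  · rw [Cardinal.mk_toType, Cardinal.card_ord, CH]

/-! ### The almost disjoint sets attached to branches. -/

open PiNat (res res_length res_eq_res)

/-- The natural number coding a node of the tree together with a tag. -/
def point (s : List Letter) (t : Option Bool) : ℕ := Encodable.encode (s, t)

theorem point_inj {s s' : List Letter} {t t' : Option Bool} :
    point s t = point s' t' ↔ s = s' ∧ t = t' := by
  rw [point, point, Encodable.encode_inj, Prod.mk.injEq]

/-- The set of points with sign `σ` attached to a branch `x`: all nodes of the branch with
tag `σ`, and the untagged nodes of the branch at which the next letter has sign `σ`. -/
def branchSet (σ : Bool) (x : Branch) : Set ℕ :=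
  {N | ∃ m t, N = point (res x m) t ∧ t.getD (x m).1 = σ}

theorem point_mem_branchSet {σ : Bool} {x : Branch} {s : List Letter} {t : Option Bool} :
    point s t ∈ branchSet σ x ↔ res x s.length = s ∧ t.getD (x s.length).1 = σ := by
  constructor
  · rintro ⟨m, t', h, ht⟩
    obtain ⟨rfl, rfl⟩ := point_inj.1 h
    simpa using ht
  · rintro ⟨h, ht⟩
    exact ⟨s.length, t, by rw [h], ht⟩

theorem exists_eq_point_of_mem {σ : Bool} {x : Branch} {N : ℕ} (h : N ∈ branchSet σ x) :
    ∃ s t, N = point s t :=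
  let ⟨_, _, h, _⟩ := h
  ⟨_, _, h⟩

theorem res_eq_res_of_le {x y : Branch} {m n : ℕ} (h : res x n = res y n) (hmn : m ≤ n) :
    res x m = res y m :=
  res_eq_res.2 fun _ hk => res_eq_res.1 h (hk.trans_le hmn)

theorem exists_res_ne {x y : Branch} (h : x ≠ y) : ∃ l, ∀ m ≥ l, res x m ≠ res y m := by
  obtain ⟨l, hl⟩ := Function.ne_iff.1 h
  exact ⟨l + 1, fun m hm hxy => hl (res_eq_res.1 hxy (by omega))⟩

theorem infinite_branchSet (σ : Bool) (x : Branch) : (branchSet σ x).Infinite := by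
  refine Set.infinite_of_injective_forall_mem (f := fun m => point (res x m) (some σ)) ?_ ?_
  · intro m n h
    simpa using congrArg List.length (point_inj.1 h).1
  · intro m
    simp [point_mem_branchSet]

theorem finite_branchSet_inter {σ τ : Bool} {x y : Branch} (h : (σ, x) ≠ (τ, y)) :
    (branchSet σ x ∩ branchSet τ y).Finite := by
  by_cases hxy : x = y
  · subst hxy
    have hστ : σ ≠ τ := fun h' => h (by rw [h'])
    convert Set.finite_empty
    rw [Set.eq_empty_iff_forall_notMem]
    rintro N ⟨h1, h2⟩
    obtain ⟨s, t, rfl⟩ := exists_eq_point_of_mem h1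
    rw [point_mem_branchSet] at h1 h2
    exact hστ (h1.2.symm.trans h2.2)
  · obtain ⟨l, hl⟩ := exists_res_ne hxy
    refine ((Set.finite_Iio l).prod (Set.finite_univ (α := Option Bool))).image
      (fun p => point (res x p.1) p.2) |>.subset ?_
    rintro N ⟨h1, h2⟩
    obtain ⟨s, t, rfl⟩ := exists_eq_point_of_mem h1
    rw [point_mem_branchSet] at h1 h2
    refine ⟨(s.length, t), ⟨?_, Set.mem_univ _⟩, by simp [h1.1]⟩
    by_contra hcon
    exact hl s.length (not_lt.1 hcon) (h1.1.trans h2.1.symm)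

theorem branchSet_injective : Function.Injective fun p : Bool × Branch => branchSet p.1 p.2 := by
  rintro ⟨σ, x⟩ ⟨τ, y⟩ h
  by_contra hne
  have h1 := finite_branchSet_inter hne
  dsimp only at h
  rw [h, Set.inter_self] at h1
  exact infinite_branchSet τ y h1

/-- The vector `1_{A} - 1_{B}` where `A` and `B` are the positive and negative sets of points of
a branch. -/
noncomputable def branchVec (x : Branch) : EllInf :=
  charFn (branchSet true x) - charFn (branchSet false x)

theorem branchVec_apply (x : Branch) (N : ℕ) :
    branchVec x N = (branchSet true x).indicator 1 N - (branchSet false x).indicator 1 N := rfl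

theorem branchVec_point (x : Branch) (s : List Letter) (t : Option Bool) :
    branchVec x (point s t) =
      if res x s.length = s then (if t.getD (x s.length).1 then 1 else -1) else 0 := by
  classical
  rw [branchVec_apply, Set.indicator_apply, Set.indicator_apply, point_mem_branchSet,
    point_mem_branchSet]
  by_cases h : res x s.length = s
  · cases t.getD (x s.length).1 <;> simp [h]
  · simp [h]

theorem branchVec_of_forall_ne {N : ℕ} (h : ∀ s t, N ≠ point s t) (x : Branch) :
    branchVec x N = 0 := by
  have : ∀ σ, N ∉ branchSet σ x := fun σ hN =>
    let ⟨s, t, h'⟩ := exists_eq_point_of_mem hN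
    h s t h'
  simp [branchVec_apply, this]

theorem abs_branchVec_apply_le (x : Branch) (N : ℕ) : |branchVec x N| ≤ 1 := by
  by_cases h : ∃ s t, N = point s t
  · obtain ⟨s, t, rfl⟩ := h
    rw [branchVec_point]
    split_ifs <;> simp
  · push Not at h
    simp [branchVec_of_forall_ne h]

theorem norm_branchVec_le (x : Branch) : ‖branchVec x‖ ≤ 1 :=
  lp.norm_le_of_forall_le zero_le_one (abs_branchVec_apply_le x)

theorem one_le_norm_branchVec_sub {x y : Branch} (h : x ≠ y) :
    1 ≤ ‖branchVec x - branchVec y‖ := by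
  obtain ⟨l, hl⟩ := exists_res_ne h
  have h1 := lp.norm_apply_le_norm ENNReal.top_ne_zero (branchVec x - branchVec y)
    (point (res x l) (some true))
  have h2 : (branchVec x - branchVec y) (point (res x l) (some true)) = 1 := by
    rw [lp.coeFn_sub, Pi.sub_apply, branchVec_point, branchVec_point, res_length, if_pos rfl,
      if_neg (hl l le_rfl).symm]
    simp
  rw [h2] at h1
  simpa using h1

/-- Codes below M involve finitely many nodes, so combinations that agree on short nodes agree on
the first M integers. -/
theorem exists_length_le (M : ℕ) : ∃ l, ∀ s t, point s t < M → s.length ≤ l := by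
  have : {p : List Letter × Option Bool | Encodable.encode p < M}.Finite :=
    (Set.finite_Iio M).preimage Encodable.encode_injective.injOn
  obtain ⟨l, hl⟩ := (this.image fun p => p.1.length).bddAbove
  exact ⟨l, fun s t h => hl ⟨(s, t), h, rfl⟩⟩

/-! ### Combinations of branch vectors before and after a split. -/

section Comb

variable {n : ℕ}

/-- The linear combination of the vectors of a tuple of branches. -/
noncomputable def comb (q : Fin n → ℝ) (v : Fin n → Branch) : EllInf :=
  ∑ i, q i • branchVec (v i)

theorem comb_apply (q : Fin n → ℝ) (v : Fin n → Branch) (N : ℕ) :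
    comb q v N = ∑ i, q i * branchVec (v i) N := by
  rw [comb, lp.coeFn_sum, Finset.sum_apply]
  rfl

theorem comb_sub_comb_apply (q : Fin n → ℝ) (v w : Fin n → Branch) (N : ℕ) :
    (comb q v - comb q w) N = ∑ i, q i * (branchVec (v i) N - branchVec (w i) N) := by
  rw [lp.coeFn_sub, Pi.sub_apply, comb_apply, comb_apply, ← Finset.sum_sub_distrib]
  simp only [mul_sub]

variable {q : Fin n → ℝ} {v w : Fin n → Branch} {t : Fin n → List Letter} {l K : ℕ}
  {J : Finset (Fin n)}

/-- On the points of the `i`th branch above the splitting level of a tuple of branches, a linear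
combination takes the values of the `i`th summand. -/
theorem comb_point_of_res (hv : ∀ i, res (v i) l = t i) (ht : Function.Injective t)
    (i : Fin n) {m : ℕ} (hm : l ≤ m) (τ : Option Bool) :
    comb q v (point (res (v i) m) τ) = q i * (if τ.getD (v i m).1 then 1 else -1) := by
  rw [comb_apply, Finset.sum_eq_single i, branchVec_point]
  · simp
  · intro j _ hji
    rw [branchVec_point, if_neg, mul_zero]
    intro h
    rw [res_length] at h
    exact hji (ht (by rw [← hv j, ← hv i]; exact res_eq_res_of_le h hm))
  · simp

theorem branchVec_point_eq_of_length_le {x y : Branch} {s : List Letter} {τ : Option Bool}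
    (hxy : ∀ j < K, x j = y j) (hK : (x K).1 = (y K).1) (hs : s.length ≤ K) :
    branchVec x (point s τ) = branchVec y (point s τ) := by
  have h1 : res x s.length = res y s.length := res_eq_res.2 fun j hj => hxy j (hj.trans_le hs)
  have h2 : (x s.length).1 = (y s.length).1 := by
    rcases hs.lt_or_eq with h | h
    · rw [hxy _ h]
    · rw [h, hK]
  rw [branchVec_point, branchVec_point, h1, h2]

theorem comb_sub_comb_eq_zero_of_length_le (hJ : ∀ i ∈ J, v i = w i)
    (hvw : ∀ i ∉ J, ∀ j < K, v i j = w i j) (hK : ∀ i ∉ J, (v i K).1 = (w i K).1)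
    {N : ℕ} (hN : ∀ s τ, N = point s τ → s.length ≤ K) :
    (comb q v - comb q w) N = 0 := by
  rw [comb_sub_comb_apply]
  refine Finset.sum_eq_zero fun i _ => ?_
  by_cases hi : i ∈ J
  · rw [hJ i hi, sub_self, mul_zero]
  by_cases h : ∃ s τ, N = point s τ
  · obtain ⟨s, τ, rfl⟩ := h
    rw [branchVec_point_eq_of_length_le (hvw i hi) (hK i hi) (hN s τ rfl), sub_self, mul_zero]
  · push Not at h
    rw [branchVec_of_forall_ne h, branchVec_of_forall_ne h, sub_self, mul_zero]

/-- Above level K ≥ l a node determines the index i of any branch through it, since the stems `t i`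
are distinct. It cannot lie on both `v i` and `w i` when i ∉ J, so one summand of size at most Q
remains. -/
theorem abs_comb_sub_comb_apply_le (hv : ∀ i, res (v i) l = t i) (hw : ∀ i, res (w i) l = t i)
    (ht : Function.Injective t) (hJ : ∀ i ∈ J, v i = w i)
    (hvw : ∀ i ∉ J, ∀ j < K, v i j = w i j) (hK : ∀ i ∉ J, (v i K).1 = (w i K).1)
    (hne : ∀ i ∉ J, v i K ≠ w i K) (hlK : l ≤ K) {Q : ℝ} (hQ : 0 ≤ Q)
    (hqQ : ∀ i ∉ J, |q i| ≤ Q) (N : ℕ) : |(comb q v - comb q w) N| ≤ Q := by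
  by_cases hN : ∀ s τ, N = point s τ → s.length ≤ K
  · rw [comb_sub_comb_eq_zero_of_length_le hJ hvw hK hN, abs_zero]
    exact hQ
  push Not at hN
  obtain ⟨s, τ, rfl, hs⟩ := hN
  rw [comb_sub_comb_apply]
  have hdet : ∀ i, branchVec (v i) (point s τ) - branchVec (w i) (point s τ) ≠ 0 →
      i ∉ J ∧ (res (v i) s.length = s ∨ res (w i) s.length = s) := by
    intro i hi
    refine ⟨fun h => hi (by rw [hJ i h, sub_self]), ?_⟩
    by_contra! hcon
    exact hi (by rw [branchVec_point, branchVec_point, if_neg hcon.1, if_neg hcon.2, sub_self])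
  have hpre : ∀ i, (res (v i) s.length = s ∨ res (w i) s.length = s) →
      ∀ j, (res (v j) s.length = s ∨ res (w j) s.length = s) → i = j := by
    have aux : ∀ {x y : Branch}, res x s.length = s → res y s.length = s →
        res x l = res y l := fun hx hy =>
      res_eq_res_of_le (hx.trans hy.symm) (hlK.trans hs.le)
    intro i hi j hj
    apply ht
    rcases hi with hi | hi <;> rcases hj with hj | hj
    · rw [← hv i, ← hv j]; exact aux hi hj
    · rw [← hv i, ← hw j]; exact aux hi hj
    · rw [← hw i, ← hv j]; exact aux hi hj
    · rw [← hw i, ← hw j]; exact aux hi hj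
  by_cases hex : ∃ i, branchVec (v i) (point s τ) - branchVec (w i) (point s τ) ≠ 0
  · obtain ⟨i, hi⟩ := hex
    obtain ⟨hiJ, hi'⟩ := hdet i hi
    rw [Finset.sum_eq_single i, abs_mul]
    · have hle : |branchVec (v i) (point s τ) - branchVec (w i) (point s τ)| ≤ 1 := by
        rw [branchVec_point, branchVec_point]
        by_cases h1 : res (v i) s.length = s
        · have h2 : res (w i) s.length ≠ s := fun h2 =>
            hne i hiJ (res_eq_res.1 (h1.trans h2.symm) hs)
          rw [if_neg h2]
          split_ifs <;> simp
        · rw [if_neg h1]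
          split_ifs <;> simp
      calc _ ≤ Q * 1 := mul_le_mul (hqQ i hiJ) hle (abs_nonneg _) hQ
        _ = Q := mul_one Q
    · intro j _ hji
      by_contra hcon
      exact hji (hpre j (hdet j (right_ne_zero_of_mul hcon)).2 i hi')
    · simp
  · push Not at hex
    simpa [hex] using hQ

/-- If the branches with index `i` split with letters of opposite signs, then the linear
combinations are far apart. -/
theorem two_mul_abs_le_norm_comb_sub_comb (hv : ∀ i, res (v i) l = t i)
    (hw : ∀ i, res (w i) l = t i) (ht : Function.Injective t) {i : Fin n}
    (hvw : ∀ j < K, v i j = w i j) (hvK : (v i K).1 = true) (hwK : (w i K).1 = false)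
    (hlK : l ≤ K) : 2 * |q i| ≤ ‖comb q v - comb q w‖ := by
  have h1 := lp.norm_apply_le_norm ENNReal.top_ne_zero (comb q v - comb q w)
    (point (res (v i) K) none)
  have h2 : (comb q v - comb q w) (point (res (v i) K) none) = 2 * q i := by
    rw [lp.coeFn_sub, Pi.sub_apply, comb_point_of_res hv ht i hlK,
      (res_eq_res.2 fun j hj => hvw j hj : res (v i) K = res (w i) K),
      comb_point_of_res hw ht i hlK]
    simp [hvK, hwK]
    ring
  rw [h2, Real.norm_eq_abs, abs_mul, abs_two] at h1
  exact h1

/-- Along the positively tagged nodes of the i-th branch g tends to 0, while the combination is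
eventually q i. -/
theorem abs_coeff_le_norm (hv : ∀ i, res (v i) l = t i) (ht : Function.Injective t)
    {g : EllInf} (hg : g ∈ cZero) (i : Fin n) : |q i| ≤ ‖g + comb q v‖ := by
  have hinj : Function.Injective fun m => point (res (v i) m) (some true) := by
    intro m m' h
    simpa using congrArg List.length (point_inj.1 h).1
  have hlim : Filter.Tendsto (fun m => g (point (res (v i) m) (some true)) + q i)
      Filter.atTop (𝓝 (0 + q i)) :=
    (Filter.Tendsto.comp hg hinj.nat_tendsto_atTop).add tendsto_const_nhds
  rw [zero_add] at hlim
  refine le_of_tendsto hlim.abs ?_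
  filter_upwards [Filter.eventually_ge_atTop l] with m hm
  have h1 := lp.norm_apply_le_norm ENNReal.top_ne_zero (g + comb q v)
    (point (res (v i) m) (some true))
  rwa [lp.coeFn_add, Pi.add_apply, comb_point_of_res hv ht i hm, Option.getD_some, if_pos rfl,
    mul_one, Real.norm_eq_abs] at h1

end Comb

/-! ### The weighted norm and the renormed space. -/

section WeightedNorm

/-- The real sequences that are square summable. -/
abbrev EllTwo : Type := lp (fun _ : ℕ => ℝ) 2

theorem abs_apply_le_norm (f : EllInf) (n : ℕ) : |f n| ≤ ‖f‖ :=
  lp.norm_apply_le_norm ENNReal.top_ne_zero f n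

theorem hasSum_const_div_two_pow (c : ℝ) : HasSum (fun n : ℕ => c / 2 ^ (n + 1)) c := by
  convert hasSum_geometric_two' c using 2 with n
  rw [pow_succ, div_div, mul_comm]

theorem sq_div_le (f : EllInf) (n : ℕ) : f n ^ 2 / 2 ^ (n + 1) ≤ ‖f‖ ^ 2 / 2 ^ (n + 1) := by
  gcongr ?_ / _
  rw [← sq_abs]
  gcongr
  exact abs_apply_le_norm f n

theorem summable_sq_div (f : EllInf) : Summable fun n : ℕ => f n ^ 2 / 2 ^ (n + 1) :=
  Summable.of_nonneg_of_le (fun _ => by positivity) (sq_div_le f)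
    (hasSum_const_div_two_pow (‖f‖ ^ 2)).summable

theorem tsum_sq_div_le (f : EllInf) : ∑' n : ℕ, f n ^ 2 / 2 ^ (n + 1) ≤ ‖f‖ ^ 2 :=
  ((summable_sq_div f).tsum_le_tsum (sq_div_le f)
    (hasSum_const_div_two_pow (‖f‖ ^ 2)).summable).trans_eq
    (hasSum_const_div_two_pow (‖f‖ ^ 2)).tsum_eq

theorem weighted_rpow (f : EllInf) (n : ℕ) :
    ‖f n / Real.sqrt (2 ^ (n + 1))‖ ^ (2 : ℝ≥0∞).toReal = f n ^ 2 / 2 ^ (n + 1) := by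
  rw [ENNReal.toReal_ofNat, Real.rpow_two, Real.norm_eq_abs, sq_abs, div_pow,
    Real.sq_sqrt (by positivity)]

/-- The weighting map from `ℓ_∞` to `ℓ_2`. -/
noncomputable def weightLin : EllInf →ₗ[ℝ] EllTwo where
  toFun f := ⟨fun n => f n / Real.sqrt (2 ^ (n + 1)), by
    refine memℓp_gen ?_
    simp only [weighted_rpow]
    exact summable_sq_div f⟩
  map_add' f g := by
    ext n
    exact add_div _ _ _
  map_smul' c f := by
    ext n
    exact mul_div_assoc _ _ _

theorem norm_weightLin (f : EllInf) :
    ‖weightLin f‖ = Real.sqrt (∑' n : ℕ, f n ^ 2 / 2 ^ (n + 1)) := by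
  rw [lp.norm_eq_tsum_rpow (by simp), Real.sqrt_eq_rpow, ENNReal.toReal_ofNat]
  congr 1
  exact tsum_congr fun n => by rw [← weighted_rpow, ENNReal.toReal_ofNat]; rfl

theorem norm_weightLin_le (f : EllInf) : ‖weightLin f‖ ≤ ‖f‖ := by
  rw [norm_weightLin]
  exact Real.sqrt_le_iff.2 ⟨norm_nonneg f, tsum_sq_div_le f⟩

theorem normInfTwo_eq (f : EllInf) : normInfTwo f = ‖f‖ + ‖weightLin f‖ := by
  rw [normInfTwo, norm_weightLin]

theorem norm_weightLin_pos {f : EllInf} (hf : f ≠ 0) : 0 < ‖weightLin f‖ := by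
  refine norm_pos_iff.2 fun h => hf ?_
  ext n
  have : f n / Real.sqrt (2 ^ (n + 1)) = 0 := congrArg (fun g : EllTwo => g n) h
  simpa using this

theorem norm_le_normInfTwo (f : EllInf) : ‖f‖ ≤ normInfTwo f := by
  rw [normInfTwo_eq]
  exact le_add_of_nonneg_right (norm_nonneg _)

theorem normInfTwo_le (f : EllInf) : normInfTwo f ≤ 2 * ‖f‖ := by
  rw [normInfTwo_eq]
  linarith [norm_weightLin_le f]

theorem normInfTwo_add_le (f g : EllInf) : normInfTwo (f + g) ≤ normInfTwo f + normInfTwo g := by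
  simp only [normInfTwo_eq, map_add]
  linarith [norm_add_le f g, norm_add_le (weightLin f) (weightLin g)]

/-- A vector bounded by one whose first coordinates vanish has a small weighted norm. -/
theorem exists_norm_weightLin_le {η : ℝ} (hη : 0 < η) :
    ∃ M : ℕ, ∀ f : EllInf, ‖f‖ ≤ 1 → (∀ n < M, f n = 0) → ‖weightLin f‖ ≤ η := by
  obtain ⟨M, hM⟩ := exists_pow_lt_of_lt_one (pow_pos hη 2) (by norm_num : (1 / 2 : ℝ) < 1)
  refine ⟨M, fun f hf h0 => ?_⟩
  rw [norm_weightLin]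
  refine Real.sqrt_le_iff.2 ⟨hη.le, ?_⟩
  rw [← (summable_sq_div f).sum_add_tsum_nat_add M,
    Finset.sum_eq_zero fun n hn => by rw [h0 n (Finset.mem_range.1 hn)]; simp, zero_add]
  refine le_trans ?_ hM.le
  rw [← (hasSum_const_div_two_pow ((1 / 2 : ℝ) ^ M)).tsum_eq]
  refine ((summable_nat_add_iff M).2 (summable_sq_div f)).tsum_le_tsum (fun n => ?_)
    (hasSum_const_div_two_pow _).summable
  refine (sq_div_le f _).trans ?_
  have h1 : ‖f‖ ^ 2 ≤ 1 := pow_le_one₀ (norm_nonneg f) hf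
  calc ‖f‖ ^ 2 / 2 ^ (n + M + 1) ≤ 1 / 2 ^ (n + M + 1) := by gcongr
    _ = (1 / 2) ^ M / 2 ^ (n + 1) := by
      rw [div_pow, one_pow, div_div, ← pow_add]; congr 2; ring

/-- The space `S` with the norm `‖·‖_{∞,2}`, as the graph of the weighting map. -/
def renormed (S : Submodule ℝ EllInf) : Submodule ℝ (WithLp 1 (EllInf × EllTwo)) where
  carrier := {v | v.fst ∈ S ∧ v.snd = weightLin v.fst}
  add_mem' := by
    rintro v w ⟨h1, h2⟩ ⟨h3, h4⟩
    exact ⟨S.add_mem h1 h3, by simp [h2, h4]⟩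
  zero_mem' := ⟨S.zero_mem, by simp⟩
  smul_mem' := by
    rintro c v ⟨h1, h2⟩
    exact ⟨S.smul_mem c h1, by simp [h2]⟩

/-- The inclusion of the renormed space in `ℓ_∞`. -/
def renormedIncl (S : Submodule ℝ EllInf) : renormed S →ₗ[ℝ] EllInf where
  toFun x := x.1.fst
  map_add' _ _ := rfl
  map_smul' _ _ := rfl

theorem renormedIncl_mem {S : Submodule ℝ EllInf} (x : renormed S) : renormedIncl S x ∈ S :=
  x.2.1

theorem norm_renormed {S : Submodule ℝ EllInf} (x : renormed S) :
    ‖x‖ = normInfTwo (renormedIncl S x) := by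
  rw [normInfTwo_eq, Submodule.coe_norm, WithLp.prod_norm_eq_of_L1, x.2.2]
  rfl

theorem exists_renormedIncl_eq {S : Submodule ℝ EllInf} {f : EllInf} (hf : f ∈ S) :
    ∃ x, renormedIncl S x = f :=
  ⟨⟨WithLp.toLp 1 (f, weightLin f), hf, rfl⟩, rfl⟩

theorem completeSpace_renormed {S : Submodule ℝ EllInf} (hS : IsClosed (S : Set EllInf)) :
    CompleteSpace (renormed S) := by
  have hT : Continuous weightLin :=
    (weightLin.mkContinuous 1 fun f => by simpa using norm_weightLin_le f).continuous
  have h1 : Continuous fun v : WithLp 1 (EllInf × EllTwo) => v.fst :=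
    WithLp.prod_continuous_ofLp 1 EllInf EllTwo |>.fst
  have h2 : Continuous fun v : WithLp 1 (EllInf × EllTwo) => v.snd :=
    WithLp.prod_continuous_ofLp 1 EllInf EllTwo |>.snd
  have : IsClosed (renormed S : Set (WithLp 1 (EllInf × EllTwo))) :=
    (hS.preimage h1).inter (isClosed_eq h2 (hT.comp h1))
  exact this.completeSpace_coe

end WeightedNorm

/-! ### Approximation by countably many types of data. -/

section Approximation

theorem exists_submodule_coe_eq_cZero : ∃ C : Submodule ℝ EllInf, (C : Set EllInf) = cZero :=
  ⟨{ carrier := cZero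
     add_mem' := fun {f g} hf hg => by simpa [cZero] using Filter.Tendsto.add hf hg
     zero_mem' := tendsto_const_nhds
     smul_mem' := fun c f hf => by simpa [cZero] using Filter.Tendsto.const_mul c hf }, rfl⟩

/-- The finitely supported sequence given by a list of rational numbers. -/
noncomputable def listVec (L : List ℚ) : EllInf :=
  ⟨fun n => ((L.getD n 0 : ℚ) : ℝ), memℓp_infty ((Set.Finite.subset
    (((Finset.range L.length).finite_toSet.image fun n => ‖((L.getD n 0 : ℚ) : ℝ)‖).union
      (Set.finite_singleton 0)) (by
    rintro _ ⟨n, rfl⟩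
    by_cases h : n < L.length
    · exact Or.inl ⟨n, by simpa using h, rfl⟩
    · exact Or.inr (by simp [List.getElem?_eq_none (not_lt.1 h)]))).bddAbove)⟩

theorem listVec_apply (L : List ℚ) (n : ℕ) : listVec L n = ((L.getD n 0 : ℚ) : ℝ) := rfl

theorem listVec_mem_cZero (L : List ℚ) : listVec L ∈ cZero := by
  refine tendsto_const_nhds.congr' ?_
  filter_upwards [Filter.eventually_ge_atTop L.length] with n hn
  rw [listVec_apply, List.getD_eq_default L 0 hn, Rat.cast_zero]

theorem exists_rat_abs_sub_le (x : ℝ) {η : ℝ} (hη : 0 < η) : ∃ q : ℚ, |x - q| ≤ η := by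
  obtain ⟨q, h1, h2⟩ := exists_rat_btwn (show x < x + η by linarith)
  exact ⟨q, abs_le.2 ⟨by linarith, by linarith⟩⟩

theorem exists_listVec_near {g : EllInf} (hg : g ∈ cZero) {η : ℝ} (hη : 0 < η) :
    ∃ L : List ℚ, ‖g - listVec L‖ ≤ η := by
  obtain ⟨M, hM⟩ := Metric.tendsto_atTop.1 hg η hη
  choose q hq using fun n => exists_rat_abs_sub_le (g n) hη
  refine ⟨(List.range M).map q, lp.norm_le_of_forall_le hη.le fun n => ?_⟩
  rw [lp.coeFn_sub, Pi.sub_apply, listVec_apply, Real.norm_eq_abs]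
  by_cases h : n < M
  · simpa [List.getD, h] using hq n
  · rw [List.getD_eq_default _ _ (by simpa using h)]
    simpa using (hM n (not_lt.1 h)).le

theorem exists_comb_near {I : Type} [LinearOrder I] (r : I → Branch) (c : I →₀ ℝ) {η : ℝ}
    (hη : 0 < η) : ∃ (n : ℕ) (z : Fin n → I) (q : Fin n → ℚ), StrictMono z ∧
      ‖(c.sum fun a b => b • branchVec (r a)) - comb (fun i => (q i : ℝ)) (r ∘ z)‖ ≤ η := by
  set z := c.support.orderEmbOfFin rfl with hz
  choose q hq using fun i => exists_rat_abs_sub_le (c (z i))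
    (div_pos hη (Nat.cast_add_one_pos c.support.card : (0 : ℝ) < _))
  refine ⟨_, z, q, z.strictMono, ?_⟩
  have h1 : (c.sum fun a b => b • branchVec (r a)) = ∑ i, c (z i) • branchVec (r (z i)) := by
    rw [Finsupp.sum]
    conv_lhs => rw [← Finset.map_orderEmbOfFin_univ c.support rfl]
    rw [Finset.sum_map]
    rfl
  rw [h1, comb, ← Finset.sum_sub_distrib]
  refine (norm_sum_le _ _).trans ?_
  calc ∑ i, ‖c (z i) • branchVec (r (z i)) - (q i : ℝ) • branchVec ((r ∘ z) i)‖
      ≤ ∑ _i : Fin c.support.card, η / (c.support.card + 1) := by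
        refine Finset.sum_le_sum fun i _ => ?_
        rw [Function.comp_apply, ← sub_smul, norm_smul]
        calc _ ≤ η / (c.support.card + 1) * 1 :=
              mul_le_mul (hq i) (norm_branchVec_le _) (norm_nonneg _) (by positivity)
          _ = _ := mul_one _
    _ = c.support.card * (η / (c.support.card + 1)) := by simp
    _ ≤ η := by
      rw [mul_div_assoc', div_le_iff₀ (by positivity)]
      nlinarith

/-- Everything except the tuple z ranges over a countable set, so uncountably many vectors can share
it. -/
theorem exists_approx {I : Type} [LinearOrder I] (r : I → Branch) {f : EllInf}
    (hf : f ∈ (Submodule.span ℝ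
      (cZero ∪ Set.range fun a => branchVec (r a))).topologicalClosure) {η : ℝ} (hη : 0 < η) :
    ∃ (n : ℕ) (z : Fin n → I) (q : Fin n → ℚ) (L : List ℚ), StrictMono z ∧
      ‖f - (listVec L + comb (fun i => (q i : ℝ)) (r ∘ z))‖ ≤ η := by
  have hη3 : 0 < η / 3 := by positivity
  obtain ⟨h, hh, hfh⟩ := Metric.mem_closure_iff.1 hf (η / 3) hη3
  obtain ⟨C, hC⟩ := exists_submodule_coe_eq_cZero
  replace hh : h ∈ Submodule.span ℝ (cZero ∪ Set.range fun a => branchVec (r a)) := hh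
  rw [Submodule.span_union, ← hC, Submodule.span_eq, Submodule.mem_sup] at hh
  obtain ⟨g, hg, k, hk, rfl⟩ := hh
  obtain ⟨c, rfl⟩ := Finsupp.mem_span_range_iff_exists_finsupp.1 hk
  obtain ⟨L, hL⟩ := exists_listVec_near (hC ▸ hg : g ∈ cZero) hη3
  obtain ⟨n, z, q, hz, hq⟩ := exists_comb_near r c hη3
  refine ⟨n, z, q, L, hz, ?_⟩
  rw [dist_eq_norm] at hfh
  set k := c.sum fun a b => b • branchVec (r a)
  have : f - (listVec L + comb (fun i => (q i : ℝ)) (r ∘ z)) =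
      (f - (g + k)) + (g - listVec L) + (k - comb (fun i => (q i : ℝ)) (r ∘ z)) := by abel
  rw [this]
  linarith [norm_add₃_le (a := f - (g + k)) (b := g - listVec L)
    (c := k - comb (fun i => (q i : ℝ)) (r ∘ z))]

theorem exists_res_injective {n : ℕ} {v : Fin n → Branch} (hv : Function.Injective v) (l₀ : ℕ) :
    ∃ l ≥ l₀, Function.Injective fun i => res (v i) l := by
  have : ∀ᶠ l in Filter.atTop, ∀ i j, i ≠ j → res (v i) l ≠ res (v j) l := by
    simp only [Filter.eventually_all]
    intro i j hij
    obtain ⟨l, hl⟩ := exists_res_ne (hv.ne hij)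
    exact Filter.eventually_atTop.2 ⟨l, hl⟩
  obtain ⟨l, h1, h2⟩ := (this.and (Filter.eventually_ge_atTop l₀)).exists
  exact ⟨l, h2, fun i j hij => by_contra fun hne => h1 i j hne hij⟩

end Approximation

theorem exists_uncountable_fiber {X C : Type*} [Countable C] {Y : Set X} (hY : ¬ Y.Countable)
    {P : X → C → Prop} (hP : ∀ x ∈ Y, ∃ c, P x c) : ∃ c, ¬ {x ∈ Y | P x c}.Countable := by
  by_contra! h
  refine hY ((Set.countable_iUnion h).mono fun x hx => ?_)
  obtain ⟨c, hc⟩ := hP x hx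
  exact Set.mem_iUnion.2 ⟨c, hx, hc⟩

/-! ### Close and distant pairs on the unit sphere. -/

section Main

variable {I : Type}

/-- The closed linear span of `c₀` and the vectors of a family of branches. -/
noncomputable def branchSpace (r : I → Branch) : Submodule ℝ EllInf :=
  (Submodule.span ℝ (cZero ∪ Set.range fun a => branchVec (r a))).topologicalClosure

theorem not_separableSpace_renormed_branchSpace {r : I → Branch} (hr : Function.Injective r)
    (hI : ¬ Countable I) : ¬ TopologicalSpace.SeparableSpace (renormed (branchSpace r)) := by
  intro hsep
  have hmem : ∀ a, branchVec (r a) ∈ branchSpace r := fun a =>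
    Submodule.le_topologicalClosure _ (Submodule.subset_span (Or.inr ⟨a, rfl⟩))
  choose u hu using fun a => exists_renormedIncl_eq (hmem a)
  have hdist : ∀ a b, a ≠ b → 1 ≤ dist (u a) (u b) := by
    intro a b hab
    rw [dist_eq_norm, norm_renormed, map_sub, hu, hu]
    exact (one_le_norm_branchVec_sub (hr.ne hab)).trans (norm_le_normInfTwo _)
  have : (Set.univ : Set I).PairwiseDisjoint fun a => Metric.ball (u a) (1 / 2) := by
    intro a _ b _ hab
    exact Metric.ball_disjoint_ball (by linarith [hdist a b hab])
  exact hI (Set.countable_univ_iff.1 (this.countable_of_isOpen (fun _ _ => Metric.isOpen_ball)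
    fun a _ => ⟨u a, Metric.mem_ball_self (by norm_num)⟩))

variable {r : I → Branch} {n : ℕ} {q : Fin n → ℝ} {t : Fin n → List Letter} {l K : ℕ}
  {J : Finset (Fin n)}

/-- Two vectors approximated by linear combinations whose branches split with letters of the same
sign are close. -/
theorem normInfTwo_sub_le {v w : Fin n → Branch} {f f' g : EllInf} {η Q : ℝ} {M l₀ : ℕ}
    (hf : ‖f - (g + comb q v)‖ ≤ η) (hf' : ‖f' - (g + comb q w)‖ ≤ η)
    (hM : ∀ f : EllInf, ‖f‖ ≤ 1 → (∀ n < M, f n = 0) → ‖weightLin f‖ ≤ η)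
    (hl₀ : ∀ s τ, point s τ < M → s.length ≤ l₀) (hl : l₀ ≤ l)
    (hv : ∀ i, res (v i) l = t i) (hw : ∀ i, res (w i) l = t i)
    (ht : Function.Injective t) (hJ : ∀ i ∈ J, v i = w i)
    (hvw : ∀ i ∉ J, ∀ j < K, v i j = w i j) (hK : ∀ i ∉ J, (v i K).1 = (w i K).1)
    (hne : ∀ i ∉ J, v i K ≠ w i K) (hlK : l ≤ K) (hQ : 0 ≤ Q) (hQ1 : Q ≤ 1)
    (hqQ : ∀ i ∉ J, |q i| ≤ Q) : normInfTwo (f - f') ≤ Q + 5 * η := by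
  have h1 : ‖comb q v - comb q w‖ ≤ Q := lp.norm_le_of_forall_le hQ
    (abs_comb_sub_comb_apply_le hv hw ht hJ hvw hK hne hlK hQ hqQ)
  have h2 : ‖weightLin (comb q v - comb q w)‖ ≤ η := hM _ (h1.trans hQ1) fun N hN =>
    comb_sub_comb_eq_zero_of_length_le hJ hvw hK fun s τ h =>
      (hl₀ s τ (h ▸ hN)).trans (hl.trans hlK)
  have h3 : f - f' = (f - (g + comb q v)) + (comb q v - comb q w) - (f' - (g + comb q w)) := by
    abel
  have h4 := normInfTwo_le (f - (g + comb q v))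
  have h5 := normInfTwo_le (-(f' - (g + comb q w)))
  rw [norm_neg] at h5
  have h6 := normInfTwo_eq (comb q v - comb q w)
  rw [h3, sub_eq_add_neg]
  have h7 := normInfTwo_add_le (f - (g + comb q v) + (comb q v - comb q w))
    (-(f' - (g + comb q w)))
  have h8 := normInfTwo_add_le (f - (g + comb q v)) (comb q v - comb q w)
  linarith

/-- Two vectors approximated by linear combinations whose `i`th branches split with letters of
opposite signs are far apart. -/
theorem le_normInfTwo_sub {v w : Fin n → Branch} {f f' g : EllInf} {η : ℝ}
    (hf : ‖f - (g + comb q v)‖ ≤ η) (hf' : ‖f' - (g + comb q w)‖ ≤ η)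
    (hv : ∀ i, res (v i) l = t i) (hw : ∀ i, res (w i) l = t i) (ht : Function.Injective t)
    {i : Fin n} (hvw : ∀ j < K, v i j = w i j) (hvK : (v i K).1 = true)
    (hwK : (w i K).1 = false) (hlK : l ≤ K) : 2 * |q i| - 2 * η ≤ normInfTwo (f - f') := by
  have h1 := two_mul_abs_le_norm_comb_sub_comb (q := q) hv hw ht hvw hvK hwK hlK
  have h3 : comb q v - comb q w = (f - f') - (f - (g + comb q v)) + (f' - (g + comb q w)) := by
    abel
  rw [h3] at h1
  have h4 := norm_add_le ((f - f') - (f - (g + comb q v))) (f' - (g + comb q w))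
  have h5 := norm_sub_le (f - f') (f - (g + comb q v))
  linarith [norm_le_normInfTwo (f - f')]

theorem exists_close_and_far [LinearOrder I] (hI : ∀ a : I, (Set.Iic a).Countable) (hinj : Function.Injective r)
    (hr : ∀ N : Set (ℕ → Branch), IsClosed N → interior N = ∅ → ∃ ξ : I, ∀ l : List I,
        l.Pairwise (· < ·) → (∀ a ∈ l, ξ < a) → interior (sectionsAt N (l.map r)) = ∅)
    {δ ε : ℝ} (hδ : 0 < δ) (hεδ : ε ≤ δ / 4) (hε : ε ≤ 1 / 2)
    {Y : Set (renormed (branchSpace r))} (hY : Y ⊆ Metric.sphere 0 1) (hYc : ¬ Y.Countable)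
    (hsep : ∀ x ∈ Y, ∀ y ∈ Y, x ≠ y → 1 - ε ≤ ‖x - y‖) :
    (∃ x ∈ Y, ∃ y ∈ Y, x ≠ y ∧ ‖x - y‖ < 1) ∧ (∃ x ∈ Y, ∃ y ∈ Y, 2 - δ < ‖x - y‖) := by
  let S := branchSpace r
  let ι := renormedIncl S
  have hnorm : ∀ x : renormed S, ‖x‖ = ‖ι x‖ + ‖weightLin (ι x)‖ := fun x => by
    rw [norm_renormed, normInfTwo_eq]
  have hnsub : ∀ x y : renormed S, ‖x - y‖ = normInfTwo (ι x - ι y) := fun x y => by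
    rw [norm_renormed, map_sub]
  have hY1 : ∀ x ∈ Y, ‖x‖ = 1 := fun x hx => by simpa using hY hx
  -- a uniform lower bound for the weighted norms
  obtain ⟨k, hk⟩ := exists_uncountable_fiber (C := ℕ) hYc
    (P := fun x k => 1 / ((k : ℝ) + 1) < ‖weightLin (ι x)‖) (by
      intro x hx
      refine exists_nat_one_div_lt (norm_weightLin_pos fun h => ?_)
      have := hY1 x hx
      rw [hnorm, h] at this
      simp at this)
  set c : ℝ := 1 / ((k : ℝ) + 1) with hc
  have hcpos : 0 < c := by positivity
  -- The bounds are used as 6η < c for the close pair, 2ε + 12η < δ for the distant pair, and 4η < 1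
  -- - ε for injectivity of z.
  obtain ⟨η, hη, hηc, hηδ, hη1⟩ : ∃ η : ℝ, 0 < η ∧ η ≤ c / 8 ∧ η ≤ δ / 32 ∧ η ≤ 1 / 32 :=
    ⟨min (c / 8) (min (δ / 32) (1 / 32)), by positivity, min_le_left _ _,
      (min_le_right _ _).trans (min_le_left _ _), (min_le_right _ _).trans (min_le_right _ _)⟩
  obtain ⟨M, hM⟩ := exists_norm_weightLin_le hη
  obtain ⟨l₀, hl₀⟩ := exists_length_le M
  -- a common type of approximation
  obtain ⟨⟨n, q, L, l, t⟩, hd⟩ := exists_uncountable_fiber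
    (C := Σ n : ℕ, (Fin n → ℚ) × List ℚ × ℕ × (Fin n → List Letter)) hk
    (P := fun x d => ∃ z : Fin d.1 → I, StrictMono z ∧
      ‖ι x - (listVec d.2.2.1 + comb (fun i => (d.2.1 i : ℝ)) (r ∘ z))‖ ≤ η ∧
      l₀ ≤ d.2.2.2.1 ∧ (∀ i, res (r (z i)) d.2.2.2.1 = d.2.2.2.2 i) ∧
      Function.Injective d.2.2.2.2) (by
        rintro x -
        obtain ⟨n, z, q, L, hz, h⟩ := exists_approx r (renormedIncl_mem x) hη
        obtain ⟨l, hl, hl'⟩ := exists_res_injective (hinj.comp hz.injective) l₀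
        exact ⟨⟨n, q, L, l, fun i => res (r (z i)) l⟩, z, hz, h, hl, fun _ => rfl, hl'⟩)
  dsimp only at hd
  set Y₂ := {x ∈ {x ∈ Y | c < ‖weightLin (ι x)‖} | ∃ z : Fin n → I, StrictMono z ∧
      ‖ι x - (listVec L + comb (fun i => (q i : ℝ)) (r ∘ z))‖ ≤ η ∧
      l₀ ≤ l ∧ (∀ i, res (r (z i)) l = t i) ∧ Function.Injective t} with hY₂
  choose z hz hzη hl hzt ht using fun x : Y₂ => x.2.2
  -- Two vectors with the same approximant are within 4η, less than the separation.
  have hzinj : Function.Injective z := by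
    intro x y hxy
    by_contra hne
    have h1 := hsep x x.2.1.1 y y.2.1.1 fun h => hne (Subtype.ext h)
    have h2 := hzη y
    rw [← hxy] at h2
    have h3 : ι x - ι y = (ι x - (listVec L + comb (fun i => (q i : ℝ)) (r ∘ z x))) -
      (ι y - (listVec L + comb (fun i => (q i : ℝ)) (r ∘ z x))) := by abel
    have h4 := normInfTwo_le (ι x - ι y)
    rw [← hnsub] at h4
    rw [h3] at h4
    linarith [norm_sub_le (ι x - (listVec L + comb (fun i => (q i : ℝ)) (r ∘ z x)))
      (ι y - (listVec L + comb (fun i => (q i : ℝ)) (r ∘ z x))), hzη x]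
  have hZ : ¬ (Set.range z).Countable := fun h => hd (Set.countable_coe_iff.1
    (have := h.to_subtype; (Set.rangeFactorization_injective.2 hzinj).countable))
  obtain ⟨J, hJ, hsplit⟩ := exists_simultaneous_splitting hI hr hZ
    (by rintro _ ⟨x, rfl⟩; exact hz x)
  obtain ⟨i, hiJ, himax⟩ := Finset.exists_max_image (Finset.univ \ J)
    (fun i => |(q i : ℝ)|) (Finset.sdiff_nonempty.2 fun h => hJ (Finset.univ_subset_iff.1 h))
  replace hiJ : i ∉ J := (Finset.mem_sdiff.1 hiJ).2
  have hqQ : ∀ j ∉ J, |(q j : ℝ)| ≤ |(q i : ℝ)| := fun j hj =>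
    himax j (Finset.mem_sdiff.2 ⟨Finset.mem_univ _, hj⟩)
  have hlK : ∀ {K : ℕ} {x y : Y₂}, r (z x i) K ≠ r (z y i) K → l ≤ K := by
    intro K x y h
    by_contra! hcon
    exact h (res_eq_res.1 ((hzt x i).trans (hzt y i).symm) hcon)
  have hQ : ∀ x : Y₂, |(q i : ℝ)| ≤ 1 - c + η := by
    intro x
    have h1 := abs_coeff_le_norm (q := fun i => (q i : ℝ)) (v := r ∘ z x) (hzt x) (ht x)
      (listVec_mem_cZero L) i
    have h2 := norm_sub_norm_le (listVec L + comb (fun i => (q i : ℝ)) (r ∘ z x)) (ι x)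
    rw [norm_sub_rev] at h2
    have h3 := hnorm x
    rw [hY1 x x.2.1.1] at h3
    linarith [hzη x, x.2.1.2]
  -- Different letters of the same sign: the branches split but the untagged node at level K does
  -- not notice.
  obtain ⟨K, -, ⟨x, rfl⟩, -, ⟨y, rfl⟩, hJxy, hxy⟩ := hsplit (true, true) (true, false)
  have hne : ∀ j ∉ J, r (z x j) K ≠ r (z y j) K := fun j hj => by
    rw [(hxy j hj).2.1, (hxy j hj).2.2]; simp
  have hclose : ‖(x : renormed S) - y‖ ≤ |(q i : ℝ)| + 5 * η := by
    rw [hnsub]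
    refine normInfTwo_sub_le (q := fun i => (q i : ℝ)) (v := r ∘ z x) (w := r ∘ z y) (J := J)
      (K := K) (hzη x) (hzη y) hM hl₀ (hl x) (hzt x) (hzt y) (ht x)
      (fun j hj => congrArg r (hJxy j hj)) (fun j hj => (hxy j hj).1) (fun j hj => ?_) hne
      (hlK (hne i hiJ)) (abs_nonneg _) (by linarith [hQ x]) hqQ
    simp [(hxy j hj).2.1, (hxy j hj).2.2]
  have hxney : (x : renormed S) ≠ y := fun h => hne i hiJ (by rw [Subtype.ext h])
  refine ⟨⟨x, x.2.1.1, y, y.2.1.1, hxney, by linarith [hQ x]⟩, ?_⟩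
  -- The close pair is still separated, so with `hclose` this bounds |q i| below by 1 - ε - 5η.
  have hlow := hsep x x.2.1.1 y y.2.1.1 hxney
  obtain ⟨K', -, ⟨x', rfl⟩, -, ⟨y', rfl⟩, -, hxy'⟩ := hsplit (true, true) (false, true)
  refine ⟨x', x'.2.1.1, y', y'.2.1.1, ?_⟩
  have hfar := le_normInfTwo_sub (q := fun i => (q i : ℝ)) (v := r ∘ z x') (w := r ∘ z y')
    (K := K') (i := i) (hzη x') (hzη y') (hzt x') (hzt y') (ht x') (hxy' i hiJ).1
    (by simp [(hxy' i hiJ).2.1]) (by simp [(hxy' i hiJ).2.2])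
    (hlK (x := x') (y := y') (by rw [(hxy' i hiJ).2.1, (hxy' i hiJ).2.2]; simp))
  rw [hnsub]
  linarith

end Main

/-! ### The family, its pairing and the final assembly. -/

/-- The family of all sets of points of the branches `r a`. -/
def branchFamily {I : Type} (r : I → Branch) : Set (Set ℕ) :=
  Set.range fun p : Bool × I => branchSet p.1 (r p.2)

theorem branchFamily_param_injective {I : Type} {r : I → Branch} (hr : Function.Injective r) :
    Function.Injective fun p : Bool × I => branchSet p.1 (r p.2) := by
  intro p p' h
  have := branchSet_injective (a₁ := (p.1, r p.2)) (a₂ := (p'.1, r p'.2)) h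
  rw [Prod.mk.injEq] at this
  exact Prod.ext this.1 (hr this.2)

theorem isADFamily_branchFamily {I : Type} (hI : ¬ Countable I) {r : I → Branch}
    (hr : Function.Injective r) : IsADFamily (branchFamily r) where
  uncountable h := by
    rw [branchFamily] at h
    have := h.to_subtype
    have := (Set.rangeFactorization_injective.2 (branchFamily_param_injective hr)).countable
    exact hI (Prod.mk_right_injective true).countable
  infinite := by
    rintro _ ⟨p, rfl⟩
    exact infinite_branchSet _ _
  almostDisjoint := by
    rintro _ ⟨p, rfl⟩ _ ⟨p', rfl⟩ h
    refine finite_branchSet_inter fun h' => h ?_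
    rw [Prod.mk.injEq] at h'
    simp only [h'.1, h'.2]

/-- The pairing of `branchFamily r` given by an enumeration of the index set of `r`. -/
def branchPairing {I : Type} {r : I → Branch} (e : branchFamily r ≃ I) (a : branchFamily r) :
    branchFamily r × branchFamily r :=
  (⟨branchSet true (r (e a)), (true, e a), rfl⟩, ⟨branchSet false (r (e a)), (false, e a), rfl⟩)

theorem isPairing_branchPairing {I : Type} {r : I → Branch} (hr : Function.Injective r)
    (e : branchFamily r ≃ I) : IsPairing (branchPairing e) where
  ne a h := by
    have := branchFamily_param_injective hr (a₁ := (true, e a)) (a₂ := (false, e a))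
      (congrArg Subtype.val h)
    simp at this
  disjoint a b hab := by
    have key : ∀ σ τ, branchSet σ (r (e b)) ≠ branchSet τ (r (e a)) := fun σ τ h =>
      hab.symm (e.injective (congrArg Prod.snd (branchFamily_param_injective hr
        (a₁ := (σ, e b)) (a₂ := (τ, e a)) h)))
    simp [branchPairing, Subtype.ext_iff, key]

/-- Reindexing along the bijection `e` leaves the set of generators unchanged. -/
theorem spaceXPairing_branchPairing {I : Type} {r : I → Branch} (e : branchFamily r ≃ I) :
    spaceXPairing (branchPairing e) = branchSpace r := by
  rw [spaceXPairing, branchSpace, ← e.surjective.range_comp]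
  rfl

theorem nonempty_branchFamily_equiv {I : Type} (hI : ¬ Countable I) {r : I → Branch}
    (hr : Function.Injective r) : Nonempty (branchFamily r ≃ I) := by
  have : Infinite I := not_finite_iff_infinite.1 fun _ => hI inferInstance
  rw [← Cardinal.eq, branchFamily, Cardinal.mk_range_eq _ (branchFamily_param_injective hr),
    Cardinal.mk_prod, Cardinal.lift_id, Cardinal.lift_id,
    Cardinal.mul_eq_right (Cardinal.aleph0_le_mk I) ?_ (by simp)]
  exact (Cardinal.mk_le_aleph0).trans (Cardinal.aleph0_le_mk I)

end ADSpace

theorem theorem1p3 (CH : (𝔠 : Cardinal.{0}) = ℵ₁) (ρ : ℝ) (hρ : 0 < ρ) :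
    ∃ (𝒜 : Set (Set ℕ)) (φ : 𝒜 → 𝒜 × 𝒜),
      ADSpace.IsADFamily 𝒜 ∧ ADSpace.IsPairing φ ∧
      ∃ (X : Type) (_ : NormedAddCommGroup X) (_ : NormedSpace ℝ X) (_ : CompleteSpace X)
        (J : X →ₗ[ℝ] ADSpace.EllInf),
        -- `X` is a subspace of `𝒳_{𝒜,φ}` (hence of `𝒳_𝒜`) with the norm `‖·‖_{∞,2}`
        (∀ x : X, J x ∈ ADSpace.spaceXPairing φ) ∧
        (∀ x : X, J x ∈ ADSpace.spaceX 𝒜) ∧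
        (∀ x : X, ‖x‖ = ADSpace.normInfTwo (J x)) ∧
        ¬ TopologicalSpace.SeparableSpace X ∧
        ∀ δ : ℝ, 0 < δ → ∃ ε : ℝ, 0 < ε ∧
          ∀ Y : Set X, Y ⊆ Metric.sphere (0 : X) 1 → ¬ Y.Countable →
            (∀ x ∈ Y, ∀ y ∈ Y, x ≠ y → 1 - ε ≤ ‖x - y‖) →
              (∃ x ∈ Y, ∃ y ∈ Y, x ≠ y ∧ ‖x - y‖ < 1) ∧
              (∃ x ∈ Y, ∃ y ∈ Y, 2 - δ - ρ < ‖x - y‖) := by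
  obtain ⟨I, _, _, hI, hcard⟩ := ADSpace.exists_index_type CH
  have hunc : ¬ Countable I := by
    rw [← Cardinal.mk_le_aleph0_iff, hcard, not_le]
    exact Cardinal.aleph0_lt_continuum
  obtain ⟨r, hinj, hr⟩ := ADSpace.exists_generic_branches
    (fun a => (hI a).mono Set.Iio_subset_Iic_self) hcard
  obtain ⟨e⟩ := ADSpace.nonempty_branchFamily_equiv hunc hinj
  have hS := ADSpace.spaceXPairing_branchPairing e
  have hmem : ∀ x : ADSpace.renormed (ADSpace.branchSpace r),
      ADSpace.renormedIncl _ x ∈ ADSpace.spaceXPairing (ADSpace.branchPairing e) := fun x => by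
    rw [hS]; exact ADSpace.renormedIncl_mem x
  refine ⟨ADSpace.branchFamily r, ADSpace.branchPairing e,
    ADSpace.isADFamily_branchFamily hunc hinj, ADSpace.isPairing_branchPairing hinj e,
    ADSpace.renormed (ADSpace.branchSpace r), inferInstance, inferInstance,
    ADSpace.completeSpace_renormed (Submodule.isClosed_topologicalClosure _),
    ADSpace.renormedIncl _, hmem, fun x => ADSpace.spaceXPairing_le _ (hmem x),
    ADSpace.norm_renormed, ADSpace.not_separableSpace_renormed_branchSpace hinj hunc,
    fun δ hδ => ⟨min (δ / 4) (1 / 2), by positivity, fun Y hY hYc hsep => ?_⟩⟩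
  obtain ⟨h1, x, hx, y, hy, hxy⟩ := ADSpace.exists_close_and_far hI hinj hr hδ
    (min_le_left _ _) (min_le_right _ _) hY hYc hsep
  exact ⟨h1, x, hx, y, hy, by linarith⟩
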